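/- There is an absolute constant $C>0$ such that the following holds. Let $N\ge 1$, let $\Gamma\in\mathbb{R}^{N\times N}$ be symmetric positive definite, let $\rho=\max_{i,j}|(\Gamma^{-1}\Gamma^{-1})_{i,j}|$, let $\beta,\tau,g,\varepsilon>0$, and let $$\mathcal K=\{W\in\mathbb{R}^{N\times N}\ \text{symmetric positive definite}:\ |W_{i,j}|\le\beta\ \text{for all } i,j,\ \operatorname{Tr}(\Gamma W\Gamma)\le\tau\},$$ $$\mathcal L\subseteq\Big\{L\in\mathbb{R}^{N\times N}\ \text{symmetric positive semidefinite}:\ \sum_{i,j}|L_{i,j}|\le g\Big\}.$$ Write $X\bullet Y=\sum_{i,j}X_{i,j}Y_{i,j}$ and $R(X)=-\ln\det(\Gamma X\Gamma+\varepsilon E)$, where $E$ is the identity matrix. Let $T\ge1$ and let $L_1,\dots,L_T\in\mathcal L$ be arbitrary. For $\eta>0$, follow-the-regularized-leader (FTRL) with regularizer $R$ and parameter $\eta$ chooses in round $t\in\{1,\dots,T\}$ a matrix $$W_t\in\arg\min_{W}\Big(R(W)+\eta\sum_{s=1}^{t-1}L_s\bullet W\Big),$$ the minimum being taken over $\mathcal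 K$ or, since it need not be attained in $\mathcal K$ (which is not closed), over the closure $\overline{\mathcal K}$: that is, $W_t\in\overline{\mathcal K}$ and its objective value is at most that of every $W\in\mathcal K$. For every $\eta>0$ such a sequence $W_1,\dots,W_T$ exists, and for every such sequence and every competitor $W^*\in\mathcal K$, $$\sum_{t=1}^T W_t\bullet L_t-\sum_{t=1}^T W^*\bullet L_t\ \le\ C\Big(g^2(\beta+\rho\varepsilon)^2\,T\,\eta+\frac{\tau}{\varepsilon\eta}\Big).$$ In particular, for $\eta=\sqrt{\dfrac{\tau}{g^2(\beta+\rho\varepsilon)^2\varepsilon T}}$, every such sequence and every $W^*\in\mathcal K$ satisfy $$\sum_{t=1}^T W_t\bullet L_t-\sum_{t=1}^T W^*\bullet L_t\ \le\ C\sqrt{\frac{g^2(\beta+\rho\varepsilon)^2\,\tau\,T}{\varepsilon}}.$$ -/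

import Mathlib

noncomputable section

namespace OSDP

/-- The Frobenius inner product `X • Y = ∑ i j, X i j * Y i j` of two real square matrices. -/
def frob {N : ℕ} (X Y : Matrix (Fin N) (Fin N) ℝ) : ℝ :=
  ∑ i, ∑ j, X i j * Y i j

/-- The decision set: (strictly) positive definite symmetric matrices with all entries bounded
by `β` in absolute value and with `Γ`-trace at most `τ`. -/
def decisionSet {N : ℕ} (Γ : Matrix (Fin N) (Fin N) ℝ) (β τ : ℝ) :
    Set (Matrix (Fin N) (Fin N) ℝ) :=
  {W | W.PosDef ∧ (∀ i j, |W i j| ≤ β) ∧ (Γ * W * Γ).trace ≤ τ}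

/-- The largest loss space: positive semidefinite symmetric matrices whose entrywise `ℓ¹` norm
is at most `g`. -/
def lossSpace (N : ℕ) (g : ℝ) : Set (Matrix (Fin N) (Fin N) ℝ) :=
  {L | L.PosSemidef ∧ ∑ i, ∑ j, |L i j| ≤ g}

/-- `ρ = max_{i,j} |(Γ⁻¹ Γ⁻¹)_{i,j}|` (a supremum over a finite index set). -/
def rho {N : ℕ} (Γ : Matrix (Fin N) (Fin N) ℝ) : ℝ :=
  ⨆ p : Fin N × Fin N, |(Γ⁻¹ * Γ⁻¹) p.1 p.2|

/-- The generalised log-determinant regularizer `R(X) = - ln det (Γ X Γ + ε E)`. -/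
def regularizer {N : ℕ} (Γ : Matrix (Fin N) (Fin N) ℝ) (ε : ℝ)
    (X : Matrix (Fin N) (Fin N) ℝ) : ℝ :=
  - Real.log (Γ * X * Γ + ε • (1 : Matrix (Fin N) (Fin N) ℝ)).det

/-- The function minimised by FTRL in round `t` (rounds are numbered `0, 1, 2, …`):
the regularizer plus `η` times the cumulative loss of the earlier rounds. -/
def ftrlObjective {N : ℕ} (Γ : Matrix (Fin N) (Fin N) ℝ) (ε η : ℝ)
    (L : ℕ → Matrix (Fin N) (Fin N) ℝ) (t : ℕ) (X : Matrix (Fin N) (Fin N) ℝ) : ℝ :=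
  regularizer Γ ε X + η * ∑ s ∈ Finset.range t, frob (L s) X

/-- `W 0, …, W (T - 1)` are the decisions of FTRL against the losses `L`: in every round the
decision minimises the FTRL objective over the decision set `K`.
Since positive definiteness is not a closed condition, a minimiser need not exist inside `K`;
the decision is therefore allowed to lie in the closure of `K`.  A decision that lies in `K` and
minimises the objective over `K` is in particular an FTRL decision in this sense. -/
def IsFTRLRun {N : ℕ} (Γ : Matrix (Fin N) (Fin N) ℝ) (β τ ε η : ℝ) (T : ℕ)
    (L W : ℕ → Matrix (Fin N) (Fin N) ℝ) : Prop :=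
  ∀ t < T, W t ∈ closure (decisionSet Γ β τ) ∧
    ∀ V ∈ decisionSet Γ β τ, ftrlObjective Γ ε η L t (W t) ≤ ftrlObjective Γ ε η L t V

/-- The regret over `T` rounds of the decisions `W` with respect to the competitor `Wstar`. -/
def regret {N : ℕ} (T : ℕ) (L W : ℕ → Matrix (Fin N) (Fin N) ℝ)
    (Wstar : Matrix (Fin N) (Fin N) ℝ) : ℝ :=
  ∑ t ∈ Finset.range T, frob (W t) (L t) - ∑ t ∈ Finset.range T, frob Wstar (L t)

end OSDP

end

namespace OSDP

open Matrix
open scoped MatrixOrder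

/-! ### Trace and log-determinant inequalities -/

section LinearAlgebra

variable {n : Type*} [Fintype n] [DecidableEq n]

/-! Regret splits into a be-the-leader term and a stability term. The first is the range of the
regularizer divided by `η`, at most `τ / (ε * η)`.

For stability, put `A`, `B` for the shifts of `W t`, `W (t + 1)` and `x = L t • (W t - W (t + 1))`.
Adding the optimality conditions of the two rounds cancels the past losses and leaves `tr ((B⁻¹ -
A⁻¹) (A - B)) ≤ η x`. The Cauchy-Schwarz bound `sq_trace_mul_sub_le` then gives `x² ≤ (L t • A) (L t
• B) η x`. Entries of `A`, `B` are at most `β + ρ ε`, so both pairings are at most `g (β + ρ ε)`;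
dividing by `x` bounds the loss per round. No Hessian is needed. -/

theorem exists_eq_transpose_mul_self {A : Matrix n n ℝ} (hA : A.PosSemidef) :
    ∃ B : Matrix n n ℝ, A = Bᵀ * B := by
  obtain ⟨B, hB⟩ := CStarAlgebra.nonneg_iff_eq_star_mul_self.mp hA.nonneg
  exact ⟨B, by simpa [star_eq_conjTranspose] using hB⟩

theorem exists_isUnit_det_eq_transpose_mul_self {A : Matrix n n ℝ} (hA : A.PosDef) :
    ∃ B : Matrix n n ℝ, IsUnit B.det ∧ A = Bᵀ * B := by
  obtain ⟨B, rfl⟩ := exists_eq_transpose_mul_self hA.posSemidef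
  refine ⟨B, ?_, rfl⟩
  have h := hA.det_pos.ne'
  rw [det_mul, det_transpose] at h
  exact (left_ne_zero_of_mul h).isUnit

theorem trace_mul_nonneg_of_posSemidef {A B : Matrix n n ℝ} (hA : A.PosSemidef)
    (hB : B.PosSemidef) : 0 ≤ (A * B).trace := by
  obtain ⟨a, rfl⟩ := exists_eq_transpose_mul_self hA
  have h := (hB.mul_mul_conjTranspose_same a).trace_nonneg
  rwa [conjTranspose_eq_transpose_of_trivial, trace_mul_comm, ← Matrix.mul_assoc] at h

/-- This is `log x ≤ x - 1` summed over the eigenvalues. -/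
theorem log_det_le_trace_sub_one {A : Matrix n n ℝ} (hA : A.PosDef) :
    Real.log A.det ≤ (A - 1).trace := by
  have hdet := hA.isHermitian.det_eq_prod_eigenvalues
  have htr := hA.isHermitian.trace_eq_sum_eigenvalues
  simp only [RCLike.ofReal_real_eq_id, id] at hdet htr
  rw [trace_sub, hdet, htr, Real.log_prod fun i _ => (hA.eigenvalues_pos i).ne',
    trace_one, Fintype.card_eq_sum_ones, Nat.cast_sum, ← Finset.sum_sub_distrib]
  refine Finset.sum_le_sum fun i _ => ?_
  simpa using Real.log_le_sub_one_of_pos (hA.eigenvalues_pos i)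

/-- The tangent inequality for the concave function `log det` at `B`. -/
theorem log_det_sub_log_det_le_trace {A B : Matrix n n ℝ} (hA : A.PosDef) (hB : B.PosDef) :
    Real.log A.det - Real.log B.det ≤ (B⁻¹ * (A - B)).trace := by
  -- Congruence by a factor of `B⁻¹ = cᵀ c` moves the base point `B` to `1`.
  obtain ⟨c, hc, hcB⟩ := exists_isUnit_det_eq_transpose_mul_self hB.inv
  have hinj : Function.Injective c.vecMul :=
    vecMul_injective_iff_isUnit.mpr ((isUnit_iff_isUnit_det c).mpr hc)
  have hpos := hA.mul_mul_conjTranspose_same hinj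
  rw [conjTranspose_eq_transpose_of_trivial] at hpos
  have hBu : IsUnit B.det := hB.det_pos.ne'.isUnit
  have hdet : (c * A * cᵀ).det = A.det * (B.det)⁻¹ := by
    have h : B⁻¹.det = c.det * c.det := by rw [hcB, det_mul, det_transpose]
    rw [det_nonsing_inv, Ring.inverse_eq_inv'] at h
    rw [det_mul, det_mul, det_transpose, h]
    ring
  have htr : (c * A * cᵀ - 1).trace = (B⁻¹ * (A - B)).trace := by
    rw [Matrix.mul_sub, nonsing_inv_mul _ hBu, trace_sub, trace_sub, hcB, Matrix.mul_assoc,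
      trace_mul_comm, Matrix.mul_assoc, trace_mul_comm A, Matrix.mul_assoc]
  have h := log_det_le_trace_sub_one hpos
  rw [hdet, htr, Real.log_mul hA.det_pos.ne' (inv_ne_zero hB.det_pos.ne'), Real.log_inv] at h
  linarith

omit [DecidableEq n] in
theorem sq_trace_transpose_mul_le (X Y : Matrix n n ℝ) :
    (Xᵀ * Y).trace ^ 2 ≤ (Xᵀ * X).trace * (Yᵀ * Y).trace := by
  have h (U V : Matrix n n ℝ) : (Uᵀ * V).trace = ∑ p : n × n, U p.1 p.2 * V p.1 p.2 := by
    rw [Fintype.sum_prod_type_right]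
    simp [trace, mul_apply]
  simp only [h, ← sq]
  exact Finset.sum_mul_sq_le_sq_mul_sq _ _ _

omit [DecidableEq n] in
theorem trace_transpose_mul_self_mul_le (X Y : Matrix n n ℝ) :
    ((X * Y)ᵀ * (X * Y)).trace ≤ (Xᵀ * X).trace * (Yᵀ * Y).trace := by
  have h (U : Matrix n n ℝ) : (Uᵀ * U).trace = ∑ j, ∑ i, U i j ^ 2 := by
    simp [trace, mul_apply, sq]
  rw [h, h X, h Y, Finset.sum_comm, Finset.sum_comm (f := fun j i => X i j ^ 2),
    Finset.sum_mul_sum]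
  refine Finset.sum_le_sum fun i _ => Finset.sum_le_sum fun j _ => ?_
  rw [mul_apply]
  exact Finset.sum_mul_sq_le_sq_mul_sq _ _ _

/-- A positive semidefinite `L` is controlled in the dual of the local norms of `-log det` at
`A` and `B` by its pairings with `A` and `B`. -/
theorem sq_trace_mul_sub_le {A B L : Matrix n n ℝ} (hA : A.PosDef) (hB : B.PosDef)
    (hL : L.PosSemidef) :
    (L * (A - B)).trace ^ 2 ≤
      (L * A).trace * (L * B).trace * ((B⁻¹ - A⁻¹) * (A - B)).trace := by
  obtain ⟨a, ha, hAa⟩ := exists_isUnit_det_eq_transpose_mul_self hA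
  obtain ⟨b, hb, hBb⟩ := exists_isUnit_det_eq_transpose_mul_self hB
  obtain ⟨l, hl⟩ := exists_eq_transpose_mul_self hL
  have hAu : IsUnit A.det := hA.det_pos.ne'.isUnit
  have hBu : IsUnit B.det := hB.det_pos.ne'.isUnit
  have hLt : Lᵀ = L := hL.isHermitian
  have hHt : (A - B)ᵀ = A - B := hA.isHermitian.sub hB.isHermitian
  have haT : IsUnit aᵀ.det := by rwa [det_transpose]
  have hbT : IsUnit bᵀ.det := by rwa [det_transpose]
  have hAi : A⁻¹ = a⁻¹ * aᵀ⁻¹ := by rw [hAa, Matrix.mul_inv_rev]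
  have hBi : B⁻¹ = b⁻¹ * bᵀ⁻¹ := by rw [hBb, Matrix.mul_inv_rev]
  set H := A - B with hH
  have hdiff : (B⁻¹ - A⁻¹) = B⁻¹ * H * A⁻¹ := by
    rw [hH, Matrix.mul_sub, Matrix.sub_mul, nonsing_inv_mul _ hBu, Matrix.mul_assoc,
      mul_nonsing_inv _ hAu, Matrix.mul_one, Matrix.one_mul]
  -- The factors of `A` and `B` sit on opposite sides, so they cancel in the pairing, and the second
  -- norm is `tr (B⁻¹ H A⁻¹ H)`, which `hdiff` identifies with the difference of inverses.
  have h1 := sq_trace_transpose_mul_le (a * L * bᵀ) (aᵀ⁻¹ * H * b⁻¹)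
  have e1 : ((a * L * bᵀ)ᵀ * (aᵀ⁻¹ * H * b⁻¹)).trace = (L * H).trace := by
    have : (a * L * bᵀ)ᵀ * (aᵀ⁻¹ * H * b⁻¹) = b * (L * (aᵀ * aᵀ⁻¹) * H * b⁻¹) := by
      simp only [transpose_mul, transpose_transpose, hLt, Matrix.mul_assoc]
    rw [this, mul_nonsing_inv _ haT, Matrix.mul_one, trace_mul_comm, Matrix.mul_assoc,
      nonsing_inv_mul _ hb, Matrix.mul_one]
  have e2 : ((aᵀ⁻¹ * H * b⁻¹)ᵀ * (aᵀ⁻¹ * H * b⁻¹)).trace = ((B⁻¹ - A⁻¹) * H).trace := by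
    have : (aᵀ⁻¹ * H * b⁻¹)ᵀ * (aᵀ⁻¹ * H * b⁻¹) = bᵀ⁻¹ * (H * A⁻¹ * H * b⁻¹) := by
      rw [hAi]
      simp only [transpose_mul, transpose_nonsing_inv, transpose_transpose, hHt, Matrix.mul_assoc]
    rw [this, hdiff, hBi, trace_mul_comm, Matrix.mul_assoc, trace_mul_comm]
    simp only [Matrix.mul_assoc]
  -- Splitting `L = lᵀ l` in the middle lets submultiplicativity separate `A` from `B`.
  have h2 : ((a * L * bᵀ)ᵀ * (a * L * bᵀ)).trace ≤ (L * A).trace * (L * B).trace := by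
    have h := trace_transpose_mul_self_mul_le (a * lᵀ) (l * bᵀ)
    have e3 : a * lᵀ * (l * bᵀ) = a * L * bᵀ := by rw [hl]; simp only [Matrix.mul_assoc]
    have e4 : ((a * lᵀ)ᵀ * (a * lᵀ)).trace = (L * A).trace := by
      rw [hl, hAa, Matrix.mul_assoc, trace_mul_comm lᵀ]
      simp only [transpose_mul, transpose_transpose, Matrix.mul_assoc]
    have e5 : ((l * bᵀ)ᵀ * (l * bᵀ)).trace = (L * B).trace := by
      rw [hl, hBb, ← Matrix.mul_assoc _ _ b, trace_mul_comm _ b]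
      simp only [transpose_mul, transpose_transpose, Matrix.mul_assoc]
    rwa [e3, e4, e5] at h
  have h3 : 0 ≤ ((aᵀ⁻¹ * H * b⁻¹)ᵀ * (aᵀ⁻¹ * H * b⁻¹)).trace := by
    simpa using (posSemidef_conjTranspose_mul_self (aᵀ⁻¹ * H * b⁻¹)).trace_nonneg
  rw [e1] at h1
  rw [e2] at h1 h3
  exact h1.trans (mul_le_mul_of_nonneg_right h2 h3)

theorem tendsto_inv_add_smul {A : Matrix n n ℝ} (hA : A.PosDef) (H : Matrix n n ℝ) :
    Filter.Tendsto (fun s : ℝ => (A + s • H)⁻¹) (nhds 0) (nhds A⁻¹) := by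
  have h1 : ContinuousAt Ring.inverse A.det := by
    rw [Ring.inverse_eq_inv']
    exact continuousAt_inv₀ hA.det_pos.ne'
  have h2 : Filter.Tendsto (fun s : ℝ => A + s • H) (nhds 0) (nhds A) := by
    have : Continuous fun s : ℝ => A + s • H := by fun_prop
    simpa using this.tendsto 0
  exact (continuousAt_matrix_inv A h1).tendsto.comp h2

end LinearAlgebra

/-! ### The FTRL objective, its minimisers and the regret -/

section FTRL

variable {N : ℕ}

theorem frob_eq_trace (X Y : Matrix (Fin N) (Fin N) ℝ) : frob X Y = (Xᵀ * Y).trace := by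
  rw [frob, Finset.sum_comm]
  simp [trace, mul_apply]

theorem frob_comm (X Y : Matrix (Fin N) (Fin N) ℝ) : frob X Y = frob Y X := by
  simp only [frob, mul_comm]

theorem frob_sub (X Y Z : Matrix (Fin N) (Fin N) ℝ) :
    frob X (Y - Z) = frob X Y - frob X Z := by
  simp only [frob_eq_trace, Matrix.mul_sub, trace_sub]

theorem frob_add_smul (X Y Z : Matrix (Fin N) (Fin N) ℝ) (s : ℝ) :
    frob X (Y + s • Z) = frob X Y + s * frob X Z := by
  simp [frob_eq_trace, Matrix.mul_add, trace_add, trace_smul]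

theorem continuous_frob (X : Matrix (Fin N) (Fin N) ℝ) : Continuous (frob X) := by
  simp only [funext (frob_eq_trace X)]
  fun_prop

theorem frob_le_of_mem_lossSpace {g b : ℝ} (hb : 0 ≤ b) {L A : Matrix (Fin N) (Fin N) ℝ}
    (hL : L ∈ lossSpace N g) (hA : ∀ i j, |A i j| ≤ b) : frob L A ≤ g * b := by
  refine le_trans ?_ (mul_le_mul_of_nonneg_right hL.2 hb)
  simp only [frob, Finset.sum_mul]
  refine Finset.sum_le_sum fun i _ => Finset.sum_le_sum fun j _ => ?_
  calc L i j * A i j ≤ |L i j| * |A i j| := by rw [← abs_mul]; exact le_abs_self _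
    _ ≤ |L i j| * b := mul_le_mul_of_nonneg_left (hA i j) (abs_nonneg _)

theorem rho_nonneg (Γ : Matrix (Fin N) (Fin N) ℝ) : 0 ≤ rho Γ :=
  Real.iSup_nonneg fun _ => abs_nonneg _

theorem abs_apply_le_rho (Γ : Matrix (Fin N) (Fin N) ℝ) (i j : Fin N) :
    |(Γ⁻¹ * Γ⁻¹) i j| ≤ rho Γ :=
  le_ciSup (f := fun p : Fin N × Fin N => |(Γ⁻¹ * Γ⁻¹) p.1 p.2|) (Set.finite_range _).bddAbove (i, j)

/-- The matrix `X + ε Γ⁻²`, which is congruent to `Γ X Γ + ε E` via `Γ`. -/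
noncomputable def shift (Γ : Matrix (Fin N) (Fin N) ℝ) (ε : ℝ) (X : Matrix (Fin N) (Fin N) ℝ) :
    Matrix (Fin N) (Fin N) ℝ :=
  X + ε • (Γ⁻¹ * Γ⁻¹)

theorem shift_sub_shift (Γ X Y : Matrix (Fin N) (Fin N) ℝ) (ε : ℝ) :
    shift Γ ε X - shift Γ ε Y = X - Y := by
  simp [shift]

theorem mul_shift_mul {Γ : Matrix (Fin N) (Fin N) ℝ} (hΓ : Γ.PosDef) (ε : ℝ)
    (X : Matrix (Fin N) (Fin N) ℝ) :
    Γ * shift Γ ε X * Γ = Γ * X * Γ + ε • (1 : Matrix (Fin N) (Fin N) ℝ) := by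
  have hu : IsUnit Γ.det := hΓ.det_pos.ne'.isUnit
  rw [shift, Matrix.mul_add, Matrix.add_mul, Matrix.mul_smul, Matrix.smul_mul,
    ← Matrix.mul_assoc Γ, mul_nonsing_inv _ hu, Matrix.one_mul, nonsing_inv_mul _ hu]

theorem posDef_shift {Γ X : Matrix (Fin N) (Fin N) ℝ} {ε : ℝ} (hΓ : Γ.PosDef) (hε : 0 < ε)
    (hX : X.PosSemidef) : (shift Γ ε X).PosDef := by
  have h2 : (Γ⁻¹ * Γ⁻¹).PosDef := by
    have hinj : Function.Injective Γ⁻¹.mulVec := mulVec_injective_iff_isUnit.mpr hΓ.inv.isUnit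
    have h := PosDef.conjTranspose_mul_self Γ⁻¹ hinj
    rwa [hΓ.inv.isHermitian.eq] at h
  exact PosDef.posSemidef_add hX (h2.smul hε)

theorem abs_shift_apply_le {Γ X : Matrix (Fin N) (Fin N) ℝ} {β ε : ℝ} (hε : 0 < ε)
    (hX : ∀ i j, |X i j| ≤ β) (i j : Fin N) : |shift Γ ε X i j| ≤ β + rho Γ * ε := by
  have h := mul_le_mul_of_nonneg_right (abs_apply_le_rho Γ i j) hε.le
  calc |shift Γ ε X i j| ≤ |X i j| + |ε * (Γ⁻¹ * Γ⁻¹) i j| := abs_add_le _ _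
    _ ≤ β + rho Γ * ε := by
      rw [abs_mul, abs_of_pos hε, mul_comm ε]
      exact add_le_add (hX i j) h

/-- Up to a constant the regularizer is `-log det` of the shift, whose entries, unlike those of `Γ X
Γ + ε E`, are bounded directly. -/
theorem regularizer_eq {Γ X : Matrix (Fin N) (Fin N) ℝ} {ε : ℝ} (hΓ : Γ.PosDef) (hε : 0 < ε)
    (hX : X.PosSemidef) :
    regularizer Γ ε X = - Real.log (shift Γ ε X).det - 2 * Real.log Γ.det := by
  have hd := hΓ.det_pos.ne'
  have hs := (posDef_shift hΓ hε hX).det_pos.ne'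
  rw [regularizer, ← mul_shift_mul hΓ, det_mul, det_mul, Real.log_mul (mul_ne_zero hd hs) hd,
    Real.log_mul hd hs]
  ring

theorem isClosed_setOf_posSemidef : IsClosed {X : Matrix (Fin N) (Fin N) ℝ | X.PosSemidef} := by
  have h : {X : Matrix (Fin N) (Fin N) ℝ | X.PosSemidef} =
      {X | Xᴴ = X} ∩ ⋂ v : Fin N → ℝ, {X | 0 ≤ star v ⬝ᵥ X *ᵥ v} := by
    ext X
    simp [posSemidef_iff_dotProduct_mulVec, IsHermitian]
  rw [h]
  refine (isClosed_eq (by fun_prop) continuous_id).inter (isClosed_iInter fun v => ?_)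
  exact isClosed_le continuous_const (by fun_prop)

theorem of_mem_closure_decisionSet {Γ X : Matrix (Fin N) (Fin N) ℝ} {β τ : ℝ}
    (hX : X ∈ closure (decisionSet Γ β τ)) :
    X.PosSemidef ∧ (∀ i j, |X i j| ≤ β) ∧ (Γ * X * Γ).trace ≤ τ := by
  have hcl : IsClosed ({X : Matrix (Fin N) (Fin N) ℝ | X.PosSemidef} ∩
      ((⋂ i, ⋂ j, {X | |X i j| ≤ β}) ∩ {X | (Γ * X * Γ).trace ≤ τ})) := by
    refine isClosed_setOf_posSemidef.inter (IsClosed.inter ?_ ?_)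
    · exact isClosed_iInter fun i => isClosed_iInter fun j =>
        isClosed_le (continuous_id.matrix_elem i j).abs continuous_const
    · exact isClosed_le (by fun_prop) continuous_const
  have h := closure_minimal (s := decisionSet Γ β τ) (fun Y hY => ?_) hcl hX
  · simpa using h
  · simpa using (show Y.PosSemidef ∧ (∀ i j, |Y i j| ≤ β) ∧ (Γ * Y * Γ).trace ≤ τ from
      ⟨hY.1.posSemidef, hY.2⟩)

theorem convex_decisionSet (Γ : Matrix (Fin N) (Fin N) ℝ) (β τ : ℝ) :
    Convex ℝ (decisionSet Γ β τ) := by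
  refine convex_iff_forall_pos.mpr fun X hX Y hY a b ha hb hab => ⟨?_, fun i j => ?_, ?_⟩
  · exact (hX.1.smul ha).add (hY.1.smul hb)
  · calc |(a • X + b • Y) i j| ≤ |a * X i j| + |b * Y i j| := abs_add_le _ _
      _ = a * |X i j| + b * |Y i j| := by rw [abs_mul, abs_mul, abs_of_pos ha, abs_of_pos hb]
      _ ≤ a * β + b * β := by gcongr; exacts [hX.2.1 i j, hY.2.1 i j]
      _ = β := by rw [← add_mul, hab, one_mul]
  · have e : (Γ * (a • X + b • Y) * Γ).trace = a * (Γ * X * Γ).trace + b * (Γ * Y * Γ).trace := by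
      simp [Matrix.mul_add, Matrix.add_mul]
    calc _ = _ := e
      _ ≤ a * τ + b * τ := by gcongr; exacts [hX.2.2, hY.2.2]
      _ = τ := by rw [← add_mul, hab, one_mul]

theorem isCompact_closure_decisionSet (Γ : Matrix (Fin N) (Fin N) ℝ) (β τ : ℝ) :
    IsCompact (closure (decisionSet Γ β τ)) := by
  refine (isCompact_Icc (a := -β) (b := β)).matrix.of_isClosed_subset isClosed_closure ?_
  exact fun X hX i j => abs_le.mp ((of_mem_closure_decisionSet hX).2.1 i j)

theorem decisionSet_nonempty (Γ : Matrix (Fin N) (Fin N) ℝ) {β τ : ℝ} (hβ : 0 < β)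
    (hτ : 0 < τ) : (decisionSet Γ β τ).Nonempty := by
  -- The added `1` keeps the denominator of the scaling factor positive.
  have hpos : 0 < |(Γ * Γ).trace| + 1 := by positivity
  set c := min β (τ / (|(Γ * Γ).trace| + 1))
  have hc0 : 0 < c := lt_min hβ (div_pos hτ hpos)
  refine ⟨c • 1, PosDef.one.smul hc0, fun i j => ?_, ?_⟩
  · rw [Matrix.smul_apply, one_apply]
    split_ifs
    · rw [smul_eq_mul, mul_one, abs_of_pos hc0]
      exact min_le_left β _
    · simpa using hβ.le
  · calc (Γ * (c • 1) * Γ).trace = c * (Γ * Γ).trace := by simp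
      _ ≤ c * (|(Γ * Γ).trace| + 1) := by gcongr; linarith [le_abs_self (Γ * Γ).trace]
      _ ≤ τ / (|(Γ * Γ).trace| + 1) * (|(Γ * Γ).trace| + 1) := by gcongr; exact min_le_right _ _
      _ = τ := div_mul_cancel₀ _ hpos.ne'

/-- The `ε` term keeps the determinant positive even at singular points of the closure. -/
theorem continuousOn_ftrlObjective {Γ : Matrix (Fin N) (Fin N) ℝ} {ε : ℝ} (hΓ : Γ.PosDef)
    (hε : 0 < ε) (β τ η : ℝ) (L : ℕ → Matrix (Fin N) (Fin N) ℝ) (t : ℕ) :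
    ContinuousOn (ftrlObjective Γ ε η L t) (closure (decisionSet Γ β τ)) := by
  have h : ContinuousOn (regularizer Γ ε) (closure (decisionSet Γ β τ)) := by
    refine (ContinuousOn.log (Continuous.continuousOn (by fun_prop)) fun X hX => ?_).neg
    have hd := hΓ.det_pos.ne'
    have hs := (posDef_shift hΓ hε (of_mem_closure_decisionSet hX).1).det_pos.ne'
    rw [← mul_shift_mul hΓ, det_mul, det_mul]
    exact mul_ne_zero (mul_ne_zero hd hs) hd
  exact h.add (continuous_const.mul
    (continuous_finsetSum _ fun s _ => continuous_frob (L s))).continuousOn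

theorem exists_isFTRLRun {Γ : Matrix (Fin N) (Fin N) ℝ} {β τ ε : ℝ} (hΓ : Γ.PosDef)
    (hβ : 0 < β) (hτ : 0 < τ) (hε : 0 < ε) (η : ℝ) (T : ℕ)
    (L : ℕ → Matrix (Fin N) (Fin N) ℝ) : ∃ W, IsFTRLRun Γ β τ ε η T L W := by
  have h (t : ℕ) := (isCompact_closure_decisionSet Γ β τ).exists_isMinOn
    (decisionSet_nonempty Γ hβ hτ).closure (continuousOn_ftrlObjective hΓ hε β τ η L t)
  choose W hW hmin using h
  exact ⟨W, fun t _ => ⟨hW t, fun V hV => hmin t (subset_closure hV)⟩⟩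

/-- By continuity, minimality passes to the closure, where the decisions of other rounds live. -/
theorem IsFTRLRun.objective_le {Γ V : Matrix (Fin N) (Fin N) ℝ} {β τ ε η : ℝ} {T t : ℕ}
    {L W : ℕ → Matrix (Fin N) (Fin N) ℝ} (h : IsFTRLRun Γ β τ ε η T L W) (hΓ : Γ.PosDef)
    (hε : 0 < ε) (ht : t < T) (hV : V ∈ closure (decisionSet Γ β τ)) :
    ftrlObjective Γ ε η L t (W t) ≤ ftrlObjective Γ ε η L t V :=
  ContinuousWithinAt.closure_le hV continuousWithinAt_const
    ((continuousOn_ftrlObjective hΓ hε β τ η L t V hV).mono subset_closure) (h t ht).2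

/-- Any run can be prolonged by one round. -/
theorem IsFTRLRun.exists_extend {Γ : Matrix (Fin N) (Fin N) ℝ} {β τ ε η : ℝ} {T : ℕ}
    {L W : ℕ → Matrix (Fin N) (Fin N) ℝ} (h : IsFTRLRun Γ β τ ε η T L W) (hΓ : Γ.PosDef)
    (hβ : 0 < β) (hτ : 0 < τ) (hε : 0 < ε) :
    ∃ W', (∀ t < T, W' t = W t) ∧ IsFTRLRun Γ β τ ε η (T + 1) L W' := by
  obtain ⟨U, hU⟩ := exists_isFTRLRun hΓ hβ hτ hε η (T + 1) L
  refine ⟨fun t => if t < T then W t else U t, fun t ht => if_pos ht, fun t ht => ?_⟩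
  by_cases htT : t < T
  · simpa only [if_pos htT] using h t htT
  · simpa only [if_neg htT] using hU t ht

/-- The variational inequality satisfied by a minimiser of the FTRL objective. -/
theorem IsFTRLRun.trace_inv_mul_sub_le {Γ V : Matrix (Fin N) (Fin N) ℝ} {β τ ε η : ℝ} {T t : ℕ}
    {L W : ℕ → Matrix (Fin N) (Fin N) ℝ} (h : IsFTRLRun Γ β τ ε η T L W) (hΓ : Γ.PosDef)
    (hε : 0 < ε) (ht : t < T) (hV : V ∈ closure (decisionSet Γ β τ)) :
    ((shift Γ ε (W t))⁻¹ * (V - W t)).trace ≤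
      η * ∑ s ∈ Finset.range t, frob (L s) (V - W t) := by
  have hW := (h t ht).1
  have hWpos := (of_mem_closure_decisionSet hW).1
  set A := shift Γ ε (W t) with hA
  set H := V - W t
  have hApos : A.PosDef := posDef_shift hΓ hε hWpos
  have hlim : Filter.Tendsto (fun s : ℝ => ((A + s • H)⁻¹ * H).trace) (nhdsWithin 0 (Set.Ioi 0))
      (nhds (A⁻¹ * H).trace) := by
    have hc : Continuous fun M : Matrix (Fin N) (Fin N) ℝ => (M * H).trace := by fun_prop
    exact ((hc.tendsto _).comp (tendsto_inv_add_smul hApos H)).mono_left nhdsWithin_le_nhds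
  refine le_of_tendsto hlim ?_
  filter_upwards [Ioo_mem_nhdsGT (zero_lt_one (α := ℝ))] with s hs
  have hmem : W t + s • H ∈ closure (decisionSet Γ β τ) :=
    (convex_decisionSet Γ β τ).closure.add_smul_sub_mem hW hV ⟨hs.1.le, hs.2.le⟩
  have hspos := (of_mem_closure_decisionSet hmem).1
  have hshift : shift Γ ε (W t + s • H) = A + s • H := by
    rw [hA, shift, shift]; abel
  have hmin := h.objective_le hΓ hε ht hmem
  -- The tangent is taken at the moved point `A + s • H`: this bounds the increment of `log det`
  -- from below, and the limit `s → 0` replaces differentiation.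
  have hlog := log_det_sub_log_det_le_trace hApos (posDef_shift hΓ hε hspos)
  rw [hshift, sub_add_cancel_left, Matrix.mul_neg, Matrix.mul_smul, trace_neg, trace_smul,
    smul_eq_mul] at hlog
  rw [ftrlObjective, ftrlObjective, regularizer_eq hΓ hε hWpos, regularizer_eq hΓ hε hspos,
    hshift, ← hA] at hmin
  simp only [frob_add_smul, Finset.sum_add_distrib, ← Finset.mul_sum] at hmin
  have hmul : s * ((A + s • H)⁻¹ * H).trace ≤
      s * (η * ∑ r ∈ Finset.range t, frob (L r) H) := by linarith
  exact le_of_mul_le_mul_left hmul hs.1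

/-- Consecutive decisions of FTRL are close to each other as seen by the current loss. -/
theorem IsFTRLRun.frob_sub_succ_le {Γ : Matrix (Fin N) (Fin N) ℝ} {β τ g ε η : ℝ} {T t : ℕ}
    {L W : ℕ → Matrix (Fin N) (Fin N) ℝ} (h : IsFTRLRun Γ β τ ε η T L W) (hΓ : Γ.PosDef)
    (hβ : 0 < β) (hg : 0 < g) (hε : 0 < ε) (hη : 0 < η) (ht : t + 1 < T)
    (hL : L t ∈ lossSpace N g) :
    frob (L t) (W t - W (t + 1)) ≤ g ^ 2 * (β + rho Γ * ε) ^ 2 * η := by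
  have hb : 0 < β + rho Γ * ε := add_pos_of_pos_of_nonneg hβ (mul_nonneg (rho_nonneg Γ) hε.le)
  have hW := (h t (Nat.lt_of_succ_lt ht)).1
  have hW' := (h (t + 1) ht).1
  obtain ⟨hp, he, -⟩ := of_mem_closure_decisionSet hW
  obtain ⟨hp', he', -⟩ := of_mem_closure_decisionSet hW'
  have h1 := h.trace_inv_mul_sub_le hΓ hε (Nat.lt_of_succ_lt ht) hW'
  have h2 := h.trace_inv_mul_sub_le hΓ hε ht hW
  have hcs := sq_trace_mul_sub_le (posDef_shift hΓ hε hp) (posDef_shift hΓ hε hp') hL.1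
  have hLt : (L t)ᵀ = L t := hL.1.isHermitian
  have hf (X : Matrix (Fin N) (Fin N) ℝ) : (L t * X).trace = frob (L t) X := by
    rw [frob_eq_trace, hLt]
  rw [hf, hf, hf, shift_sub_shift, Matrix.sub_mul, trace_sub] at hcs
  have hneg : W (t + 1) - W t = -(W t - W (t + 1)) := (neg_sub _ _).symm
  have hfneg (s : ℕ) : frob (L s) (-(W t - W (t + 1))) = -frob (L s) (W t - W (t + 1)) := by
    rw [frob_eq_trace, frob_eq_trace, Matrix.mul_neg, trace_neg]
  rw [hneg, Matrix.mul_neg, trace_neg] at h1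
  simp only [hfneg, Finset.sum_neg_distrib] at h1
  rw [Finset.sum_range_succ, mul_add] at h2
  have hA0 : 0 ≤ frob (L t) (shift Γ ε (W t)) := by
    rw [← hf]; exact trace_mul_nonneg_of_posSemidef hL.1 (posDef_shift hΓ hε hp).posSemidef
  have hB0 : 0 ≤ frob (L t) (shift Γ ε (W (t + 1))) := by
    rw [← hf]; exact trace_mul_nonneg_of_posSemidef hL.1 (posDef_shift hΓ hε hp').posSemidef
  have hA := frob_le_of_mem_lossSpace hb.le hL (abs_shift_apply_le (Γ := Γ) hε he)
  have hB := frob_le_of_mem_lossSpace hb.le hL (abs_shift_apply_le (Γ := Γ) hε he')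
  set x := frob (L t) (W t - W (t + 1))
  rcases le_or_gt x 0 with hx0 | hx0
  · exact hx0.trans (by positivity)
  have hAB := mul_le_mul hA hB hB0 (by positivity)
  -- In the sum of `h1` and `h2` the losses before round `t` cancel.
  have hD : ((shift Γ ε (W (t + 1)))⁻¹ * (W t - W (t + 1))).trace -
      ((shift Γ ε (W t))⁻¹ * (W t - W (t + 1))).trace ≤ η * x := by linarith
  have hfin : x * x ≤ g ^ 2 * (β + rho Γ * ε) ^ 2 * η * x := by
    calc x * x = x ^ 2 := (sq x).symm
      _ ≤ _ := hcs
      _ ≤ frob (L t) (shift Γ ε (W t)) * frob (L t) (shift Γ ε (W (t + 1))) * (η * x) :=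
        mul_le_mul_of_nonneg_left hD (mul_nonneg hA0 hB0)
      _ ≤ g * (β + rho Γ * ε) * (g * (β + rho Γ * ε)) * (η * x) :=
        mul_le_mul_of_nonneg_right hAB (by positivity)
      _ = _ := by ring
  exact le_of_mul_le_mul_right hfin hx0

/-- The be-the-leader inequality. -/
theorem IsFTRLRun.regularizer_add_le_objective {Γ : Matrix (Fin N) (Fin N) ℝ} {β τ ε η : ℝ}
    {T t : ℕ} {L W : ℕ → Matrix (Fin N) (Fin N) ℝ} (h : IsFTRLRun Γ β τ ε η T L W)
    (hΓ : Γ.PosDef) (hε : 0 < ε) (ht : t < T) :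
    regularizer Γ ε (W 0) + η * ∑ s ∈ Finset.range t, frob (L s) (W (s + 1)) ≤
      ftrlObjective Γ ε η L t (W t) := by
  induction t with
  | zero => simp [ftrlObjective]
  | succ t ih =>
    have h1 := ih (Nat.lt_of_succ_lt ht)
    have h2 := h.objective_le hΓ hε (Nat.lt_of_succ_lt ht) (h (t + 1) ht).1
    simp only [ftrlObjective, Finset.sum_range_succ, mul_add] at h1 h2 ⊢
    linarith

/-- Both values are compared with `log det (ε E)`: the tangent there bounds the `Y` side by `τ / ε`,
and monotonicity of `det` disposes of the `X` side. -/
theorem regularizer_sub_regularizer_le {Γ X Y : Matrix (Fin N) (Fin N) ℝ} {τ ε : ℝ}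
    (hΓ : Γ.PosDef) (hε : 0 < ε) (hX : X.PosSemidef) (hY : Y.PosSemidef)
    (hYτ : (Γ * Y * Γ).trace ≤ τ) : regularizer Γ ε X - regularizer Γ ε Y ≤ τ / ε := by
  have hconj {Z : Matrix (Fin N) (Fin N) ℝ} (hZ : Z.PosSemidef) : (Γ * Z * Γ).PosSemidef := by
    have h := hZ.mul_mul_conjTranspose_same Γ
    rwa [hΓ.isHermitian.eq] at h
  have hE : (ε • (1 : Matrix (Fin N) (Fin N) ℝ)).PosDef := PosDef.one.smul hε
  have hXE := PosDef.posSemidef_add (hconj hX) hE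
  have hYE := PosDef.posSemidef_add (hconj hY) hE
  have h1 := log_det_sub_log_det_le_trace hYE hE
  have h2 := log_det_sub_log_det_le_trace hE hXE
  have h3 := trace_mul_nonneg_of_posSemidef hXE.inv.posSemidef (hconj hX)
  rw [sub_add_cancel_right, Matrix.mul_neg, trace_neg] at h2
  have hinv : (ε • (1 : Matrix (Fin N) (Fin N) ℝ))⁻¹ = ε⁻¹ • 1 :=
    inv_eq_left_inv (by simp [smul_smul, hε.ne'])
  rw [add_sub_cancel_right, hinv, Matrix.smul_mul, Matrix.one_mul, trace_smul, smul_eq_mul] at h1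
  have h4 : ε⁻¹ * (Γ * Y * Γ).trace ≤ τ / ε := by
    rw [div_eq_inv_mul]
    exact mul_le_mul_of_nonneg_left hYτ (inv_pos.mpr hε).le
  rw [regularizer, regularizer]
  linarith

/-- The regret bound of FTRL with the log-determinant regularizer. -/
theorem IsFTRLRun.regret_le {Γ Wstar : Matrix (Fin N) (Fin N) ℝ} {β τ g ε η : ℝ} {T : ℕ}
    {L W : ℕ → Matrix (Fin N) (Fin N) ℝ} (h : IsFTRLRun Γ β τ ε η T L W) (hΓ : Γ.PosDef)
    (hβ : 0 < β) (hτ : 0 < τ) (hg : 0 < g) (hε : 0 < ε) (hη : 0 < η)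
    (hL : ∀ t < T, L t ∈ lossSpace N g) (hWstar : Wstar ∈ decisionSet Γ β τ) :
    regret T L W Wstar ≤ g ^ 2 * (β + rho Γ * ε) ^ 2 * T * η + τ / (ε * η) := by
  -- Stability in the last round refers to a decision in round `T`, which the given run need not
  -- supply.
  obtain ⟨U, hUW, hU⟩ := h.exists_extend hΓ hβ hτ hε
  have hmem := hU 0 T.succ_pos
  obtain ⟨hU0, -, hUτ⟩ := of_mem_closure_decisionSet hmem.1
  have hbtl := (hU.regularizer_add_le_objective hΓ hε T.lt_succ_self).trans
    ((hU T T.lt_succ_self).2 Wstar hWstar)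
  have hR := regularizer_sub_regularizer_le hΓ hε hWstar.1.posSemidef hU0 hUτ
  have hstab : ∑ t ∈ Finset.range T, frob (L t) (U t - U (t + 1)) ≤
      T * (g ^ 2 * (β + rho Γ * ε) ^ 2 * η) := by
    have := Finset.sum_le_card_nsmul (Finset.range T)
      (fun t => frob (L t) (U t - U (t + 1))) _ fun t ht =>
      hU.frob_sub_succ_le hΓ hβ hg hε hη (Nat.succ_lt_succ (Finset.mem_range.mp ht))
        (hL t (Finset.mem_range.mp ht))
    simpa using this
  simp only [frob_sub, Finset.sum_sub_distrib] at hstab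
  have hreg : regret T L W Wstar =
      ∑ t ∈ Finset.range T, frob (L t) (U t) - ∑ t ∈ Finset.range T, frob (L t) Wstar := by
    rw [regret]
    congr 1
    · exact Finset.sum_congr rfl fun t ht => by
        rw [hUW t (Finset.mem_range.mp ht), frob_comm]
    · exact Finset.sum_congr rfl fun t _ => frob_comm _ _
  rw [ftrlObjective] at hbtl
  have hlead : ∑ t ∈ Finset.range T, frob (L t) (U (t + 1)) -
      ∑ t ∈ Finset.range T, frob (L t) Wstar ≤ τ / (ε * η) := by
    rw [← div_div, le_div_iff₀ hη]
    linarith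
  rw [hreg]
  linarith

end FTRL

end OSDP

theorem mainTheorem1 :
    ∃ C : ℝ, 0 < C ∧
      ∀ (N : ℕ) (_hN : 1 ≤ N)
        (Γ : Matrix (Fin N) (Fin N) ℝ) (_hΓ : Γ.PosDef)
        (β τ g ε : ℝ) (_hβ : 0 < β) (_hτ : 0 < τ) (_hg : 0 < g) (_hε : 0 < ε)
        (lossSet : Set (Matrix (Fin N) (Fin N) ℝ)) (_hlossSet : lossSet ⊆ OSDP.lossSpace N g)
        (T : ℕ) (_hT : 1 ≤ T)
        (L : ℕ → Matrix (Fin N) (Fin N) ℝ) (_hL : ∀ t < T, L t ∈ lossSet),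
        (∀ η : ℝ, 0 < η →
          (∃ W : ℕ → Matrix (Fin N) (Fin N) ℝ, OSDP.IsFTRLRun Γ β τ ε η T L W) ∧
          ∀ W : ℕ → Matrix (Fin N) (Fin N) ℝ, OSDP.IsFTRLRun Γ β τ ε η T L W →
            ∀ Wstar ∈ OSDP.decisionSet Γ β τ,
              OSDP.regret T L W Wstar ≤
                C * (g ^ 2 * (β + OSDP.rho Γ * ε) ^ 2 * T * η + τ / (ε * η))) ∧
        (∀ W : ℕ → Matrix (Fin N) (Fin N) ℝ,
          OSDP.IsFTRLRun Γ β τ ε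
              (Real.sqrt (τ / (g ^ 2 * (β + OSDP.rho Γ * ε) ^ 2 * ε * T))) T L W →
            ∀ Wstar ∈ OSDP.decisionSet Γ β τ,
              OSDP.regret T L W Wstar ≤
                C * Real.sqrt (g ^ 2 * (β + OSDP.rho Γ * ε) ^ 2 * τ * T / ε)) := by
  -- `regret_le` has constant 1; the tuned `η` makes its two terms equal, whence the 2.
  refine ⟨2, two_pos, fun N _ Γ hΓ β τ g ε hβ hτ hg hε lossSet hloss T hT L hL => ?_⟩
  have hL' : ∀ t < T, L t ∈ OSDP.lossSpace N g := fun t ht => hloss (hL t ht)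
  have hb : 0 < β + OSDP.rho Γ * ε :=
    add_pos_of_pos_of_nonneg hβ (mul_nonneg (OSDP.rho_nonneg Γ) hε.le)
  have hT0 : (0 : ℝ) < T := Nat.cast_pos.mpr hT
  refine ⟨fun η hη => ⟨OSDP.exists_isFTRLRun hΓ hβ hτ hε η T L, fun W hW Wstar hWstar => ?_⟩,
    fun W hW Wstar hWstar => ?_⟩
  · refine (hW.regret_le hΓ hβ hτ hg hε hη hL' hWstar).trans ?_
    exact le_mul_of_one_le_left (by positivity) one_le_two
  · set G := g ^ 2 * (β + OSDP.rho Γ * ε) ^ 2 with hG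
    have hG0 : 0 < G := by positivity
    set η := Real.sqrt (τ / (G * ε * T)) with hη
    have hη0 : 0 < η := Real.sqrt_pos.mpr (by positivity)
    have hη2 : η ^ 2 = τ / (G * ε * T) := Real.sq_sqrt (by positivity)
    have hτε : τ / (ε * η) = G * T * η := by
      rw [div_eq_iff (by positivity)]
      calc τ = τ / (G * ε * T) * (G * ε * T) := (div_mul_cancel₀ _ (by positivity)).symm
        _ = _ := by rw [← hη2]; ring
    have hsqrt : Real.sqrt (G * τ * T / ε) = G * T * η := by
      rw [Real.sqrt_eq_iff_eq_sq (by positivity) (by positivity), mul_pow, hη2]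
      field_simp
    have hreg := hW.regret_le hΓ hβ hτ hg hε hη0 hL' hWstar
    rw [← hG, hτε] at hreg
    rw [hsqrt]
    linarith
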